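/- Let $r,k,s_1,\dots,s_k\ge 0$ be integers. The quiver $\Gamma$ has vertices $(l)$ for $1\le l\le r$ and $(i;j)$ for $1\le i\le k$, $0\le j\le s_i$, one arrow $(l)\to(i;0)$ for all $l,i$, and one arrow $(i;j)\to(i;j-1)$ for $1\le j\le s_i$ and all $i$. Let $\mu^i=(\mu^i_1\ge\dots\ge\mu^i_{s_i+1}\ge 0)$, $1\le i\le k$, be non-zero partitions with $|\mu^i|+\mu^i_1\le r$, put $n_i=|\mu^i|$ and $\mu^i_0=r-n_i$, and let $\mathbf v_{\boldsymbol\mu}$ be the dimension vector with $v_{(l)}=1$ and $v_{(i;j)}=n_i-\sum_{f=1}^{j}\mu^i_f$. *Permutations.* Let $S_{\tilde{\boldsymbol\mu}}$ be the set of $\mathbf w=(w_1,\dots,w_k)\in (S_r)^k$ such that each $w_i^{-1}$ is increasing on each of the consecutive blocks of $\{1,\dots,r\}$ of sizes $\mu^i_1,\mu^i_2,\dots,\mu^i_{s_i+1},\mu^i_0$ (in this order). A permutation $w$ is identified with the matrix with entries $\delta_{a,w(b)}$. For a field $\kappa$, let $U_w$ be the group of matrices $u\in\mathrm{GL}_r(\kappa)$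 with $1$'s on the diagonal and, for $a\neq b$, $u_{a,b}=0$ unless $b<a$ and $w(a)<w(b)$. *The polynomial.* The inversion graph $K_{\mathbf w}$ has vertices $1,\dots,r$ and, for each $t\in\{1,\dots,k\}$ and each pair $b<a$ with $w_t(a)<w_t(b)$, one edge of colour $t$ between $a$ and $b$ (so multiple edges are allowed). Put $$R_{\mathbf w}(q)=\sum_{K\subset K_{\mathbf w}}(q-1)^{b_1(K)},\qquad b_1(K)=e(K)-r+1,$$ the sum being over the connected subgraphs $K$ of $K_{\mathbf w}$ that contain all $r$ vertices, where $e(K)$ is the number of edges of $K$ (so $R_{\mathbf w}=0$ if $K_{\mathbf w}$ is not connected). *The strata.* Let $\mathbb X_{\boldsymbol\mu}(\kappa)$ be the set of representations $\varphi$ of $\Gamma$ over $\kappa$ of dimension vector $\mathbf v_{\boldsymbol\mu}$, on the spaces $V_{(l)}=\kappa$, $V_{(i;j)}=\kappa^{v_{(i;j)}}$, such that all maps $V_{(i;j)}\to V_{(i;j-1)}$ are injective and, for every $i$, the images of the maps $V_{(l)}\to V_{(i;0)}$, $1\le l\le r$, span $V_{(i;0)}$. For $\varphi\in\mathbb X_{\boldsymbol\mu}(\kappa)$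 let $E^{j}_i\subset\kappa^{n_i}=V_{(i;0)}$ be the image of $V_{(i;j)}$ and $M_i\in\mathrm{Mat}_{n_i,r}(\kappa)$ the matrix whose columns are the vectors defining the maps $V_{(1)},\dots,V_{(r)}\to V_{(i;0)}$. The stratum $\mathbb X^{\mathbf w}_{\boldsymbol\mu}(\kappa)$ is the set of those $\varphi\in\mathbb X_{\boldsymbol\mu}(\kappa)$ that correspond to a point of $w_1U_{w_1}\times\dots\times w_kU_{w_k}$, that is, for which there are $u_i\in U_{w_i}$ and $g_i\in\mathrm{GL}_{n_i}(\kappa)$, $1\le i\le k$, such that $g_iE^{j}_i$ is the span of the last $v_{(i;j)}$ coordinate vectors for $0\le j\le s_i$, and $g_iM_i$ is the matrix formed by the first $n_i$ rows of $w_iu_i$. *Theorem.* For every $\mathbf w\in S_{\tilde{\boldsymbol\mu}}$ and every finite field $\mathbb F_q$, the number of isomorphism classes of absolutely indecomposable representations of $\Gamma$ over $\mathbb F_q$ (those that are indecomposable over $\mathbb F_q$ and over every finite extension of $\mathbb F_q$) that lie in $\mathbb X^{\mathbf w}_{\boldsymbol\mu}(\mathbb F_q)$ equals $R_{\mathbf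 w}(q)$. -/

import Mathlib

open scoped Polynomial

universe u

/-! ### Representations of quivers in coordinates -/

/-- A representation of the quiver `I` over `κ` on the spaces `κ ^ (d a)`, `a ∈ I`: for every arrow
`γ : a ⟶ b` the matrix of a linear map `κ ^ (d a) → κ ^ (d b)`. -/
abbrev MatRep (κ : Type*) {I : Type*} [Quiver I] (d : I → Type*) :=
  ∀ ⦃a b : I⦄, (a ⟶ b) → Matrix (d b) (d a) κ

/-- `Rep_{Γ,v}(κ)`: representations of dimension vector `v`. -/
abbrev QRep (κ : Type*) {I : Type*} [Quiver I] (v : I → ℕ) :=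
  MatRep κ (fun a : I => Fin (v a))

namespace MatRep

variable {κ : Type*} [Field κ] {I : Type*} [Quiver I]

/-- Isomorphism of representations. -/
def Iso {d e : I → Type*} [∀ a, Fintype (d a)] [∀ a, Fintype (e a)]
    (φ : MatRep κ d) (ψ : MatRep κ e) : Prop :=
  ∃ g : ∀ a, (d a → κ) ≃ₗ[κ] (e a → κ),
    ∀ (a b : I) (γ : a ⟶ b) (x : d a → κ), g b ((φ γ).mulVec x) = (ψ γ).mulVec (g a x)

/-- Direct sum of two representations. -/
def directSum {d e : I → Type*} (φ : MatRep κ d) (ψ : MatRep κ e) :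
    MatRep κ (fun a => d a ⊕ e a) :=
  fun _ _ γ => Matrix.fromBlocks (φ γ) 0 0 (ψ γ)

/-- Extension of scalars. -/
def baseChange {d : I → Type*} (L : Type*) [Field L] [Algebra κ L] (φ : MatRep κ d) :
    MatRep L d :=
  fun _ _ γ => (φ γ).map (algebraMap κ L)

end MatRep

namespace QRep

variable {κ : Type*} [Field κ] {I : Type*} [Quiver I] {v : I → ℕ}

/-- Indecomposable: non-zero, and not isomorphic to a direct sum of two non-zero representations.
A representation is zero exactly when its dimension vector is. -/
def Indecomposable (φ : QRep κ v) : Prop :=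
  v ≠ 0 ∧ ∀ (v₁ v₂ : I → ℕ) (φ₁ : QRep κ v₁) (φ₂ : QRep κ v₂),
    MatRep.Iso φ (MatRep.directSum φ₁ φ₂) → v₁ = 0 ∨ v₂ = 0

/-- Absolutely indecomposable: indecomposable, also over every finite extension of `κ`. (Every
finite extension has a copy in the universe of `κ`.) -/
def AbsolutelyIndecomposable {κ : Type u} [Field κ] {I : Type*} [Quiver I] {v : I → ℕ}
    (φ : QRep κ v) : Prop :=
  Indecomposable φ ∧
    ∀ (L : Type u) [Field L] [Algebra κ L] [FiniteDimensional κ L],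
      Indecomposable (v := v) (MatRep.baseChange L φ)

variable (κ v) in
/-- Isomorphism of representations of a fixed dimension vector as an equivalence relation. -/
def isoSetoid : Setoid (QRep κ v) where
  r φ ψ := MatRep.Iso φ ψ
  iseqv :=
    { refl := fun _ => ⟨fun _ => LinearEquiv.refl κ _, fun _ _ _ _ => rfl⟩
      symm := by
        rintro φ ψ ⟨g, hg⟩
        refine ⟨fun a => (g a).symm, fun a b γ x => ?_⟩
        rw [LinearEquiv.symm_apply_eq, hg, LinearEquiv.apply_symm_apply]
      trans := by
        rintro φ ψ χ ⟨g, hg⟩ ⟨h, hh⟩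
        refine ⟨fun a => (g a).trans (h a), fun a b γ x => ?_⟩
        simp only [LinearEquiv.trans_apply, hg, hh] }

variable (κ v) in
/-- The set of isomorphism classes of representations of dimension vector `v`. -/
abbrev IsoClass := Quotient (isoSetoid κ v)

/-- The isomorphism class of a representation. -/
def isoClass (φ : QRep κ v) : IsoClass κ v := Quotient.mk (isoSetoid κ v) φ

end QRep

/-! ### The complete bipartite supernova quiver -/

/-- Vertices: the tips `(l)` of the short legs, and the vertices `(i;j)`, `0 ≤ j ≤ s i`, of the
long legs. -/
inductive Supernova (r k : ℕ) (s : Fin k → ℕ) : Type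
  | tip (l : Fin r) : Supernova r k s
  | leg (i : Fin k) (j : Fin (s i + 1)) : Supernova r k s

namespace Supernova

/-- Arrows: `(l) → (i;0)` for all `l`, `i`, and `(i;j+1) → (i;j)` for `0 ≤ j < s i`. -/
inductive Arrow (r k : ℕ) (s : Fin k → ℕ) : Supernova r k s → Supernova r k s → Type
  | short (l : Fin r) (i : Fin k) : Arrow r k s (tip l) (leg i 0)
  | long (i : Fin k) (j : Fin (s i)) : Arrow r k s (leg i j.succ) (leg i j.castSucc)

instance (r k : ℕ) (s : Fin k → ℕ) : Quiver (Supernova r k s) where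
  Hom := Arrow r k s

/-- The arrow `(l) → (i;0)`. -/
def short {r k : ℕ} {s : Fin k → ℕ} (l : Fin r) (i : Fin k) :
    (tip l : Supernova r k s) ⟶ leg i 0 := Arrow.short l i

/-- The arrow `(i;j+1) → (i;j)`. -/
def long {r k : ℕ} {s : Fin k → ℕ} (i : Fin k) (j : Fin (s i)) :
    (leg i j.succ : Supernova r k s) ⟶ leg i j.castSucc := Arrow.long i j

/-- The partial sum `m 0 + ⋯ + m (j-1)` of the first `j` parts of `m` (all parts if `j > n`). -/
def cut {n : ℕ} (m : Fin (n + 1) → ℕ) (j : ℕ) : ℕ :=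
  ∑ f : Fin (n + 1) with f.1 < j, m f

variable {r k : ℕ} {s : Fin k → ℕ}

/-- The dimension vector `v_μ`: `1` at the tips and `|μ^i|` minus the sum of the first `j` parts
of `μ^i` at `(i;j)`. Parts are indexed from `0`. -/
def dimVec (r : ℕ) (μ : ∀ i : Fin k, Fin (s i + 1) → ℕ) : Supernova r k s → ℕ
  | tip _ => 1
  | leg i j => (∑ f, μ i f) - cut (μ i) j

theorem dimVec_leg_zero (μ : ∀ i : Fin k, Fin (s i + 1) → ℕ) (i : Fin k) :
    dimVec r μ (leg i 0) = ∑ f, μ i f := by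
  simp [dimVec, cut]

/-! ### Permutations, cells and inversion graphs -/

/-- The permutations `w` of the rows `0, …, r-1` such that `w⁻¹` is increasing on each block, where
the rows are cut into consecutive blocks of sizes `m 0, m 1, …, m n, r - |m|` from the top (two
rows are in the same block when no cut separates them). Equivalently, the permutation matrix
of `w` is in row echelon form. -/
def blockPerms (r : ℕ) {n : ℕ} (m : Fin (n + 1) → ℕ) : Set (Equiv.Perm (Fin r)) :=
  {w | ∀ a b : Fin r, (∀ j : ℕ, a.1 < cut m j ↔ b.1 < cut m j) → a < b → w⁻¹ a < w⁻¹ b}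

/-- The permutation matrix of `w`, with entry `1` at `(w b, b)` for all `b`. -/
def permMat (κ : Type*) [Field κ] (w : Equiv.Perm (Fin r)) : Matrix (Fin r) (Fin r) κ :=
  Matrix.of fun a b => if a = w b then 1 else 0

/-- The group `U_w = ∏ U_{a,b}` over the inversions `b < a`, `w a < w b`, where
`U_{a,b} = {1 + x E_{a,b}}`. As inversions are closed under `(a,b), (b,c) ↦ (a,c)`, it consists of
the matrices with `1` on the diagonal that vanish off the diagonal except at inversions. -/
def unip (κ : Type*) [Field κ] (w : Equiv.Perm (Fin r)) : Set (Matrix (Fin r) (Fin r) κ) :=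
  {u | (∀ a, u a a = 1) ∧ ∀ a b, a ≠ b → ¬ (b < a ∧ w a < w b) → u a b = 0}

/-- The edges of the inversion graph `K_w` on the vertices `0, …, r-1`: an edge `(t, a, b)` of
colour `t` joining `a` and `b` whenever `b < a` and `w t a < w t b`. -/
def invEdges (w : Fin k → Equiv.Perm (Fin r)) : Finset (Fin k × Fin r × Fin r) :=
  Finset.univ.filter fun e => e.2.2 < e.2.1 ∧ w e.1 e.2.1 < w e.1 e.2.2

/-- Connectedness of the graph with vertices `0, …, r-1` and edge set `A` (colours and
multiplicities do not matter for this; the empty graph is not connected). -/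
def EdgesConnected (A : Finset (Fin k × Fin r × Fin r)) : Prop :=
  (SimpleGraph.fromRel fun a b : Fin r => ∃ t, (t, a, b) ∈ A).Connected

open Classical in
/-- The polynomial `R_w = ∑ (q-1)^{b₁(K)}` over the connected subgraphs `K` of `K_w` on all `r`
vertices, `b₁(K) = e(K) - r + 1`. The truncated subtraction is harmless, since a connected graph on
`r` vertices has at least `r - 1` edges. -/
noncomputable def Rpoly (w : Fin k → Equiv.Perm (Fin r)) : ℤ[X] :=
  ∑ A ∈ (invEdges w).powerset with EdgesConnected A, (Polynomial.X - 1) ^ (A.card + 1 - r)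

/-! ### The strata of the representation space -/

variable {κ : Type*} [Field κ] {μ : ∀ i : Fin k, Fin (s i + 1) → ℕ}

/-- The matrix with `r` columns formed by the vectors `φ_{(l) → (i;0)}`. -/
def tipMatrix (φ : QRep κ (dimVec r μ)) (i : Fin k) :
    Matrix (Fin (dimVec r μ (leg i 0))) (Fin r) κ :=
  Matrix.of fun a l => φ (short l i) a (0 : Fin 1)

/-- The composite `V_{(i;j)} → V_{(i;0)}` of the maps along the `i`-th long leg. -/
def legMap (φ : QRep κ (dimVec r μ)) (i : Fin k) (j : Fin (s i + 1)) :
    Matrix (Fin (dimVec r μ (leg i 0))) (Fin (dimVec r μ (leg i j))) κ :=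
  Fin.induction (motive := fun j =>
      Matrix (Fin (dimVec r μ (leg i 0))) (Fin (dimVec r μ (leg i j))) κ)
    1 (fun j A => A * φ (long i j)) j

/-- The member `E^j` of the flag of the `i`-th long leg: the image of `V_{(i;j)} → V_{(i;0)}`. -/
def legFlag (φ : QRep κ (dimVec r μ)) (i : Fin k) (j : Fin (s i + 1)) :
    Submodule κ (Fin (dimVec r μ (leg i 0)) → κ) :=
  LinearMap.range (legMap φ i j).mulVecLin

/-- The subspace of `κ ^ N` of the vectors whose first `c` coordinates vanish. -/
def stdSubspace (κ : Type*) [Field κ] (N c : ℕ) : Submodule κ (Fin N → κ) where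
  carrier := {x | ∀ a : Fin N, a.1 < c → x a = 0}
  add_mem' hx hy a ha := by simp [hx a ha, hy a ha]
  zero_mem' _ _ := rfl
  smul_mem' t x hx a ha := by simp [hx a ha]

variable (κ μ) in
/-- The set `X_μ` of representations for which the maps on the long legs are injective and the
images of the maps `V_{(l)} → V_{(i;0)}` span `V_{(i;0)}` for every `i`. -/
def goodReps (r : ℕ) : Set (QRep κ (dimVec r μ)) :=
  {φ | (∀ (i : Fin k) (j : Fin (s i)), Function.Injective (φ (long i j)).mulVec) ∧
    ∀ i : Fin k, ⨆ l : Fin r, LinearMap.range (φ (short l i)).mulVecLin = ⊤}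

variable (κ μ) in
/-- The stratum `X_μ^w`: the representations `φ` in `X_μ` that correspond to an element
`(w_1 u_1, …, w_k u_k)` with `u_i ∈ U_{w_i}`. For each `i`, some `g` in `GL(V_{(i;0)})` moves the
flag of the `i`-th long leg to the standard flag (whose stabilizer is the group of block lower
triangular matrices with diagonal blocks of sizes `μ^i_1, μ^i_2, …` from the top) and moves
the matrix of the maps `V_{(l)} → V_{(i;0)}` to its row echelon form, which is `w_i u_i` without
its last `r - |μ^i|` rows. -/
def stratum (h : ∀ i, dimVec r μ (leg i 0) ≤ r) (w : Fin k → Equiv.Perm (Fin r)) :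
    Set (QRep κ (dimVec r μ)) :=
  {φ | φ ∈ goodReps κ μ r ∧ ∃ u : Fin k → Matrix (Fin r) (Fin r) κ,
    (∀ i, u i ∈ unip κ (w i)) ∧
    ∀ i, ∃ g : Matrix.GeneralLinearGroup (Fin (dimVec r μ (leg i 0))) κ,
      (∀ j, (legFlag φ i j).map g.1.mulVecLin = stdSubspace κ _ (cut (μ i) j)) ∧
      g.1 * tipMatrix φ i = (permMat κ (w i) * u i).submatrix (Fin.castLE (h i)) id}

end Supernova

/-! Every representation in the stratum is isomorphic to an `echelonRep` with `u_i ∈ U_{w_i}`: `g_i`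
makes the flags standard, and injectivity along the long legs carries this to all `V_{(i;j)}`
(`exists_iso_echelonRep`). Each basis vector of the model is labelled by a tip, its pivot column; in
terms of labels, short arrows are submatrices of `u_i` and long arrows submatrices of the identity.

A homomorphism between two such models acts at each tip `l` by a scalar `t_l`. These scalars
determine it, since the tips span `V_{(i;0)}` and the legs inject (`hom_eq_zero`). Uniqueness of
reduced echelon forms gives `t u_i = u'_i t` (`diagonal_intertwines`, `tipScalar_intertwines`), and
conversely any invertible diagonal `t` with this property gives an isomorphism (`echelonRep_iso`).
So isomorphism classes are the orbits of the torus `(κˣ)^r`, acting by conjugation on the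
off-diagonal entries, which are supported on edges of `K_w`.

If the support is connected, the tip scalars of an endomorphism are all equal, so every idempotent
is `0` or `1`; if not, the labels split the representation. Field extension does not change the
support, so absolute indecomposability means that the support is a connected spanning subgraph.
There are `(q-1)^|A|` parameters with support `A`. For connected `A` the stabilizer in the torus
consists of the scalars, so orbits have `(q-1)^(r-1)` elements and `A` contributes `(q-1)^(|A|-r+1)`
classes, the term of `A` in `R_w(q)`. -/

namespace Supernova

/-! ### Echelon forms -/

section Echelon

variable {κ : Type*} [Field κ] {r : ℕ}

/-- A non-zero combination of rows of a matrix in `U_w` has its last non-zero entry at a pivot. -/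
theorem exists_pivot {w : Equiv.Perm (Fin r)} {u : Matrix (Fin r) (Fin r) κ} (hu : u ∈ unip κ w)
    {ι : Type*} [Fintype ι] {f : ι → Fin r} (hf : Function.Injective f) {c : ι → κ} (hc : c ≠ 0) :
    ∃ q, c q ≠ 0 ∧ ∑ p, c p * u (f p) (f q) = c q := by
  classical
  have hne : (Finset.univ.filter fun p => c p ≠ 0).Nonempty := by
    obtain ⟨p, hp⟩ := Function.ne_iff.1 hc
    exact ⟨p, by simpa using hp⟩
  -- Take the rightmost pivot column among rows with non-zero coefficient: `u` is lower triangular,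
  -- so no other such row meets that column.
  obtain ⟨q, hq, hmax⟩ := Finset.exists_max_image _ f hne
  refine ⟨q, (Finset.mem_filter.1 hq).2, ?_⟩
  rw [Finset.sum_eq_single q, hu.1, mul_one]
  · intro p _ hpq
    by_cases hp : c p = 0
    · rw [hp, zero_mul]
    · have hle := hmax p (by simpa using hp)
      rw [hu.2 _ _ (fun h => hpq (hf h)) (fun h => absurd h.1 (not_lt.2 hle)), mul_zero]
  · simp

theorem cut_le_sum {n : ℕ} (m : Fin (n + 1) → ℕ) (j : ℕ) : cut m j ≤ ∑ f, m f :=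
  Finset.sum_le_sum_of_subset (Finset.filter_subset _ _)

theorem cut_mono {n : ℕ} (m : Fin (n + 1) → ℕ) {i j : ℕ} (h : i ≤ j) : cut m i ≤ cut m j :=
  Finset.sum_le_sum_of_subset fun f hf => by
    simp only [Finset.mem_filter, Finset.mem_univ, true_and] at hf ⊢
    omega

theorem cut_eq_sum {n : ℕ} (m : Fin (n + 1) → ℕ) {j : ℕ} (h : n < j) : cut m j = ∑ f, m f := by
  rw [cut, Finset.filter_true_of_mem]
  intro f _
  omega

/-- Since `w⁻¹` is increasing on blocks, the two rows of an inversion cannot lie in the same block.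
-/
theorem exists_cut_of_inversion {n : ℕ} {m : Fin (n + 1) → ℕ} {w : Equiv.Perm (Fin r)}
    (hw : w ∈ blockPerms r m) {a b : Fin r} (hba : b < a) (hab : w a < w b) :
    ∃ j, (w a).1 < cut m j ∧ cut m j ≤ (w b).1 := by
  by_contra! h
  have := hw (w a) (w b) (fun j => ⟨fun hj => h j hj, fun hj => lt_trans hab hj⟩) hab
  simp only [Equiv.Perm.inv_def, Equiv.symm_apply_apply] at this
  exact absurd hba this.asymm

/-- Uniqueness of the reduced echelon form, up to a diagonal matrix: if a block lower triangular
matrix `g` and a diagonal matrix `t` intertwine the first rows of `w u` and `w u'`, then `t`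
intertwines `u` and `u'`. -/
theorem diagonal_intertwines {n : ℕ} {m : Fin (n + 1) → ℕ} {w : Equiv.Perm (Fin r)}
    (hw : w ∈ blockPerms r m) {u u' : Matrix (Fin r) (Fin r) κ}
    (hu : u ∈ unip κ w) (hu' : u' ∈ unip κ w) {N : ℕ} (hN : N = ∑ f, m f)
    (row : Fin N → Fin r) (hrow : ∀ p, (w (row p)).1 = p.1)
    (g : Fin N → Fin N → κ) (t : Fin r → κ)
    (hg : ∀ p q : Fin N, ∀ j, j ≤ n → p.1 < cut m j → cut m j ≤ q.1 → g p q = 0)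
    (h : ∀ p b, ∑ q, g p q * u (row q) b = u' (row p) b * t b) (a b : Fin r) :
    t a * u a b = u' a b * t b := by
  classical
  have hinj : Function.Injective row := fun p q hpq => Fin.ext (by rw [← hrow, ← hrow, hpq])
  have hoff : ∀ v ∈ unip κ w, ∀ a b, v a b ≠ 0 → a = b ∨ (b < a ∧ w a < w b) := by
    intro v hv a b hab
    by_contra! hcon
    exact hab (hv.2 a b hcon.1 fun hi => absurd hi.2 (not_lt.2 (hcon.2 hi.1)))
  by_cases hdiag : a = b
  · subst hdiag
    rw [hu.1, hu'.1, mul_one, one_mul]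
  by_cases ha : (w a).1 < N
  · obtain ⟨p, rfl⟩ : ∃ p, row p = a :=
      ⟨⟨(w a).1, ha⟩, w.injective (Fin.ext (hrow _))⟩
    -- Row `p` of `g - t`, with `t` placed on the pivots. It is shown to vanish: its rightmost pivot
    -- column would be an inversion with `row p`, a cut then separates rows `p` and `q`, and block
    -- triangularity of `g` kills that entry.
    let c : Fin N → κ := fun q => g p q - if q = p then t (row p) else 0
    have hsum : ∀ b, ∑ q, c q * u (row q) b = u' (row p) b * t b - t (row p) * u (row p) b := by
      intro b
      simp only [c, sub_mul, Finset.sum_sub_distrib, h, ite_mul, zero_mul, Finset.sum_ite_eq',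
        Finset.mem_univ, if_true]
    have hc : c = 0 := by
      by_contra hc
      obtain ⟨q, hq, hs⟩ := exists_pivot hu hinj hc
      rw [hsum] at hs
      have hne : row p ≠ row q := by
        intro he
        rw [← he, hu.1, hu'.1, mul_one, one_mul, sub_self] at hs
        exact hq hs.symm
      have hinv : row q < row p ∧ w (row p) < w (row q) := by
        by_contra hcon
        rw [hu.2 _ _ hne hcon, hu'.2 _ _ hne hcon] at hs
        simp at hs
        exact hq hs.symm
      obtain ⟨j, hj1, hj2⟩ := exists_cut_of_inversion hw hinv.1 hinv.2
      rw [hrow] at hj1 hj2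
      apply hq
      have hqp : q ≠ p := fun he => hne (by rw [he])
      simp only [c, if_neg hqp, sub_zero]
      refine hg p q j ?_ hj1 hj2
      by_contra! hjn
      have := cut_eq_sum m hjn
      omega
    have := hsum b
    simp only [hc, Pi.zero_apply, zero_mul, Finset.sum_const_zero] at this
    exact (sub_eq_zero.1 this.symm).symm
  -- Row `w a` lies in the last block, below every cut, so row `a` of `u` and `u'` is trivial:
  -- nothing is lost by omitting these rows.
  · have hninv : ¬ (b < a ∧ w a < w b) := by
      rintro ⟨h1, h2⟩
      obtain ⟨j, hj1, hj2⟩ := exists_cut_of_inversion hw h1 h2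
      have := cut_le_sum m j
      omega
    rw [hu.2 _ _ hdiag hninv, hu'.2 _ _ hdiag hninv, mul_zero, zero_mul]

end Echelon

/-! ### Representations in echelon form -/

section EchelonRep

variable {κ : Type*} [Field κ] {r k : ℕ} {s : Fin k → ℕ} {μ : ∀ i : Fin k, Fin (s i + 1) → ℕ}

theorem cut_add_lt (hn : ∀ i, ∑ f, μ i f ≤ r) (i : Fin k) (j : Fin (s i + 1))
    (p : Fin (dimVec r μ (leg i j))) : cut (μ i) j + p.1 < r := by
  have h1 := p.2
  have h2 := hn i
  simp only [dimVec] at h1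
  omega

/-- The basis vectors of a representation in echelon form are labelled by the tips: the one of
row `p` on the `i`-th long leg by the pivot column `w_i⁻¹ p`. -/
def label (hn : ∀ i, ∑ f, μ i f ≤ r) (w : Fin k → Equiv.Perm (Fin r)) :
    ∀ a : Supernova r k s, Fin (dimVec r μ a) → Fin r
  | tip l, _ => l
  | leg i j, p => (w i)⁻¹ ⟨cut (μ i) j + p.1, cut_add_lt hn i j p⟩

/-- The matrix of an arrow in terms of labels. -/
def arrowCoeff (u : Fin k → Matrix (Fin r) (Fin r) κ) :
    ∀ {a b : Supernova r k s}, (a ⟶ b) → Matrix (Fin r) (Fin r) κ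
  | _, _, Arrow.short _ i => u i
  | _, _, Arrow.long _ _ => 1

/-- The representation given by the echelon forms `w_i u_i`. -/
def echelonRep (hn : ∀ i, ∑ f, μ i f ≤ r) (w : Fin k → Equiv.Perm (Fin r))
    (u : Fin k → Matrix (Fin r) (Fin r) κ) : QRep κ (dimVec r μ) :=
  fun a b γ => Matrix.of fun x y => arrowCoeff u γ (label hn w b x) (label hn w a y)

variable {hn : ∀ i, ∑ f, μ i f ≤ r} {w : Fin k → Equiv.Perm (Fin r)}
  {u u' : Fin k → Matrix (Fin r) (Fin r) κ}

theorem label_leg_eq_iff {i : Fin k} {j j' : Fin (s i + 1)} {p : Fin (dimVec r μ (leg i j))}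
    {p' : Fin (dimVec r μ (leg i j'))} :
    label hn w (leg i j) p = label hn w (leg i j') p' ↔
      cut (μ i) j + p.1 = cut (μ i) j' + p'.1 := by
  simp [label]

theorem tipMatrix_echelonRep_apply (i : Fin k) (x) (l : Fin r) :
    tipMatrix (echelonRep hn w u) i x l = u i (label hn w (leg i 0) x) l := rfl

theorem echelonRep_long (i : Fin k) (j : Fin (s i)) (x y) :
    echelonRep hn w u (long i j) x y =
      if cut (μ i) j.castSucc + x.1 = cut (μ i) j.succ + y.1 then 1 else 0 := by
  have : echelonRep hn w u (long i j) x y =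
    (1 : Matrix (Fin r) (Fin r) κ) (label hn w (leg i j.castSucc) x)
      (label hn w (leg i j.succ) y) := rfl
  rw [this, Matrix.one_apply]
  simp only [label_leg_eq_iff]

theorem legMap_zero (φ : QRep κ (dimVec r μ)) (i : Fin k) : legMap φ i 0 = 1 := rfl

theorem legMap_succ (φ : QRep κ (dimVec r μ)) (i : Fin k) (j : Fin (s i)) :
    legMap φ i j.succ = legMap φ i j.castSucc * φ (long i j) := rfl

theorem cut_zero {n : ℕ} (m : Fin (n + 1) → ℕ) : cut m 0 = 0 := by simp [cut]

theorem legMap_echelonRep (i : Fin k) (j : Fin (s i + 1)) (x y) :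
    legMap (echelonRep hn w u) i j x y = if x.1 = cut (μ i) j + y.1 then 1 else 0 := by
  induction j using Fin.induction with
  | zero =>
    rw [legMap_zero, Matrix.one_apply]
    simp [cut_zero, Fin.ext_iff]
  | succ j ih =>
    rw [legMap_succ, Matrix.mul_apply]
    have hy := y.2
    simp only [dimVec] at hy
    have hc : cut (μ i) j.castSucc ≤ cut (μ i) j.succ := cut_mono _ (by simp)
    -- The index at `(i;j)` of the same row of the echelon form as `y` at `(i;j+1)`.
    let z : Fin (dimVec r μ (leg i j.castSucc)) :=
      ⟨cut (μ i) j.succ + y.1 - cut (μ i) j.castSucc, by simp only [dimVec]; omega⟩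
    rw [Finset.sum_eq_single z]
    · rw [ih, echelonRep_long, if_pos (show _ + z.1 = _ by simp only [z]; omega), mul_one]
      congr 1
      simp only [z, eq_iff_iff]
      omega
    · intro p _ hp
      rw [echelonRep_long, if_neg, mul_zero]
      intro he
      exact hp (Fin.ext (by simp only [z]; omega))
    · simp

theorem legMap_echelonRep_mulVec (i : Fin k) (j : Fin (s i + 1))
    (v : Fin (dimVec r μ (leg i j)) → κ) (x : Fin (dimVec r μ (leg i 0))) :
    (legMap (echelonRep hn w u) i j).mulVec v x =
      if h : cut (μ i) j ≤ x.1 then v ⟨x.1 - cut (μ i) j, by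
        have := x.2; simp only [dimVec, Fin.val_zero, cut_zero] at this ⊢; omega⟩ else 0 := by
  simp only [Matrix.mulVec, dotProduct, legMap_echelonRep, ite_mul, one_mul, zero_mul]
  split_ifs with h
  · rw [Finset.sum_eq_single ⟨x.1 - cut (μ i) j, by
        have := x.2; simp only [dimVec, Fin.val_zero, cut_zero] at this ⊢; omega⟩, if_pos]
    · simp only; omega
    · intro p _ hp
      rw [if_neg]
      intro he
      exact hp (Fin.ext (by simp only; omega))
    · simp
  · refine Finset.sum_eq_zero fun p _ => if_neg ?_
    omega

theorem legMap_echelonRep_injective (i : Fin k) (j : Fin (s i + 1)) :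
    Function.Injective (legMap (echelonRep hn w u) i j).mulVec := by
  intro v v' h
  ext p
  have hp := p.2
  simp only [dimVec] at hp
  have := congrFun h ⟨cut (μ i) j + p.1, by simp only [dimVec, Fin.val_zero, cut_zero]; omega⟩
  simpa [legMap_echelonRep_mulVec] using this

theorem legFlag_echelonRep (i : Fin k) (j : Fin (s i + 1)) :
    legFlag (echelonRep hn w u) i j = stdSubspace κ _ (cut (μ i) j) := by
  ext x
  constructor
  · rintro ⟨v, rfl⟩ a ha
    rw [Matrix.mulVecLin_apply, legMap_echelonRep_mulVec, dif_neg (by omega)]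
  · intro hx
    refine ⟨fun p => x ⟨cut (μ i) j + p.1, ?_⟩, ?_⟩
    · have hp := p.2
      simp only [dimVec, Fin.val_zero, cut_zero] at hp ⊢
      omega
    · ext a
      rw [Matrix.mulVecLin_apply, legMap_echelonRep_mulVec]
      split_ifs with h
      · congr 1
        ext
        simp only; omega
      · exact (hx a (by omega)).symm

theorem legMap_injective {φ : QRep κ (dimVec r μ)}
    (hφ : ∀ (i : Fin k) (j : Fin (s i)), Function.Injective (φ (long i j)).mulVec)
    (i : Fin k) (j : Fin (s i + 1)) : Function.Injective (legMap φ i j).mulVec := by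
  induction j using Fin.induction with
  | zero =>
    rw [legMap_zero]
    intro x y h
    simpa using h
  | succ j ih =>
    rw [legMap_succ]
    intro x y h
    simp only [← Matrix.mulVec_mulVec] at h
    exact hφ i j (ih h)

theorem tipMatrix_echelonRep (h : ∀ i, dimVec r μ (leg i 0) ≤ r) (i : Fin k) :
    tipMatrix (echelonRep hn w u) i =
      (permMat κ (w i) * u i).submatrix (Fin.castLE (h i)) id := by
  ext p b
  have hwp : Fin.castLE (h i) p = w i (label hn w (leg i 0) p) := by
    simp [label, cut_zero, Fin.ext_iff]
  change u i (label hn w (leg i 0) p) b = (permMat κ (w i) * u i) (Fin.castLE (h i) p) b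
  simp only [Matrix.mul_apply, permMat, Matrix.of_apply, ite_mul, one_mul, zero_mul, hwp,
    (w i).injective.eq_iff]
  simp

theorem short_mulVec (φ : QRep κ (dimVec r μ)) (l : Fin r) (i : Fin k)
    (x : Fin (dimVec r μ (tip l : Supernova r k s)) → κ) :
    (φ (short l i)).mulVec x = x (0 : Fin 1) • fun p => tipMatrix φ i p l := by
  ext p
  simp only [Matrix.mulVec, dotProduct, Pi.smul_apply, smul_eq_mul]
  exact (Fin.sum_univ_one _).trans (mul_comm _ _)

theorem label_zero_injective (i : Fin k) :
    Function.Injective (label hn w (leg i 0)) := fun p q h => by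
  have := label_leg_eq_iff.1 h
  exact Fin.ext (by omega)

theorem echelonRep_mem_goodReps (hu : ∀ i, u i ∈ unip κ (w i)) :
    echelonRep hn w u ∈ goodReps κ μ r := by
  refine ⟨fun i j x y h => ?_, fun i => ?_⟩
  · apply legMap_echelonRep_injective (hn := hn) (w := w) (u := u) i j.succ
    simp only [legMap_succ, ← Matrix.mulVec_mulVec, h]
  · by_contra hne
    -- If the columns did not span, a non-zero functional would kill them all; but it is a
    -- combination of rows, hence non-zero at one of the pivot columns.
    obtain ⟨f, hf, hle⟩ := Submodule.exists_le_ker_of_lt_top _ (lt_top_iff_ne_top.2 hne)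
    have hc : (fun p => f (Pi.single p 1)) ≠ 0 := fun h0 =>
      hf (LinearMap.pi_ext' fun p => LinearMap.ext_ring (by simpa using congrFun h0 p))
    obtain ⟨q, hq, hs⟩ := exists_pivot (hu i) (label_zero_injective (hn := hn) (w := w) i) hc
    apply hq
    rw [← hs]
    have hmem : (echelonRep hn w u (short (label hn w (leg i 0) q) i)).mulVec (fun _ => 1) ∈
        LinearMap.ker f :=
      hle (Submodule.mem_iSup_of_mem (label hn w (leg i 0) q) (LinearMap.mem_range_self
        (Matrix.mulVecLin (echelonRep hn w u (short (label hn w (leg i 0) q) i))) fun _ => 1))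
    rw [LinearMap.mem_ker, short_mulVec, one_smul, LinearMap.pi_apply_eq_sum_univ f] at hmem
    rw [← hmem]
    refine Finset.sum_congr rfl fun p _ => ?_
    rw [tipMatrix_echelonRep_apply, smul_eq_mul, mul_comm]
    congr 2
    ext p'
    simp [Pi.single_apply, eq_comm]

theorem echelonRep_mem_stratum (h : ∀ i, dimVec r μ (leg i 0) ≤ r)
    (hu : ∀ i, u i ∈ unip κ (w i)) : echelonRep hn w u ∈ stratum κ μ h w := by
  refine ⟨echelonRep_mem_goodReps hu, u, hu, fun i => ⟨1, fun j => ?_, ?_⟩⟩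
  · rw [legFlag_echelonRep]
    simp
  · rw [tipMatrix_echelonRep h]
    simp

end EchelonRep
end Supernova

/-! ### Homomorphisms -/

namespace MatRep

variable {κ : Type*} [Field κ] {I : Type*} [Quiver I]

/-- Homomorphisms of representations. -/
def IsHom {d e : I → Type*} [∀ a, Fintype (d a)] [∀ a, Fintype (e a)]
    (φ : MatRep κ d) (ψ : MatRep κ e) (f : ∀ a, (d a → κ) →ₗ[κ] (e a → κ)) : Prop :=
  ∀ (a b : I) (γ : a ⟶ b) (x : d a → κ), f b ((φ γ).mulVec x) = (ψ γ).mulVec (f a x)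

end MatRep

namespace Supernova

section Hom

variable {κ : Type*} [Field κ] {r k : ℕ} {s : Fin k → ℕ} {μ : ∀ i : Fin k, Fin (s i + 1) → ℕ}
  {φ ψ : QRep κ (dimVec r μ)}
  {f : ∀ a : Supernova r k s, (Fin (dimVec r μ a) → κ) →ₗ[κ] (Fin (dimVec r μ a) → κ)}

/-- The scalars by which a homomorphism acts at the tips. -/
def tipScalar (f : ∀ a : Supernova r k s,
    (Fin (dimVec r μ a) → κ) →ₗ[κ] (Fin (dimVec r μ a) → κ)) (l : Fin r) : κ :=
  f (tip l) (fun _ => 1) (0 : Fin 1)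

theorem tip_eq_smul_one {l : Fin r} (x : Fin (dimVec r μ (tip l : Supernova r k s)) → κ) :
    x = x (0 : Fin 1) • fun _ => 1 := by
  funext p
  obtain rfl : p = (0 : Fin 1) := Subsingleton.elim (α := Fin 1) _ _
  exact (mul_one _).symm

theorem map_tip {l : Fin r} (x : Fin (dimVec r μ (tip l : Supernova r k s)) → κ) :
    f (tip l) x = tipScalar f l • x := by
  conv_lhs => rw [tip_eq_smul_one x, map_smul, tip_eq_smul_one (f (tip l) fun _ => 1)]
  conv_rhs => rw [tip_eq_smul_one x]
  rw [smul_comm]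
  rfl

theorem hom_legMap (hf : MatRep.IsHom φ ψ f) (i : Fin k) (j : Fin (s i + 1))
    (x : Fin (dimVec r μ (leg i j)) → κ) :
    f (leg i 0) ((legMap φ i j).mulVec x) = (legMap ψ i j).mulVec (f (leg i j) x) := by
  induction j using Fin.induction with
  | zero => simp only [legMap_zero, Matrix.one_mulVec]
  | succ j ih =>
    simp only [legMap_succ, ← Matrix.mulVec_mulVec, ih]
    rw [hf _ _ (long i j)]

theorem hom_column (hf : MatRep.IsHom φ ψ f) (i : Fin k) (l : Fin r) :
    f (leg i 0) (fun p => tipMatrix φ i p l) =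
      tipScalar f l • fun p => tipMatrix ψ i p l := by
  have := hf _ _ (short l i) fun _ => 1
  simp only [short_mulVec, one_smul] at this
  exact this

/-- The images of the tips span `V_{(i;0)}`, so vanishing at the tips propagates there; injectivity
of the legs of `ψ` then carries it to every `V_{(i;j)}`. -/
theorem hom_eq_zero (hφ : φ ∈ goodReps κ μ r) (hψ : ψ ∈ goodReps κ μ r)
    (hf : MatRep.IsHom φ ψ f) (h0 : tipScalar f = 0) (a : Supernova r k s) : f a = 0 := by
  have hzero : ∀ i, f (leg i 0) = 0 := by
    intro i
    rw [← LinearMap.ker_eq_top, eq_top_iff, ← hφ.2 i, iSup_le_iff]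
    rintro l _ ⟨x, rfl⟩
    rw [LinearMap.mem_ker, Matrix.mulVecLin_apply, short_mulVec, map_smul, hom_column hf, h0]
    simp
  cases a with
  | tip l =>
    ext1 x
    ext1
    rw [LinearMap.comp_apply, map_tip, h0]
    simp
  | leg i j =>
    refine LinearMap.ext fun x => legMap_injective hψ.1 i j ?_
    rw [← hom_legMap hf, hzero]
    simp

variable {hn : ∀ i, ∑ f, μ i f ≤ r} {w : Fin k → Equiv.Perm (Fin r)}
  {u u' : Fin k → Matrix (Fin r) (Fin r) κ}

/-- At `(i;0)` a homomorphism preserves the standard flag, so its matrix is block lower triangular,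
and it maps column `b` to `t_b` times column `b`: this is the situation of `diagonal_intertwines`.
-/
theorem tipScalar_intertwines (hw : ∀ i, w i ∈ blockPerms r (μ i))
    (hu : ∀ i, u i ∈ unip κ (w i)) (hu' : ∀ i, u' i ∈ unip κ (w i))
    (hf : MatRep.IsHom (echelonRep hn w u) (echelonRep hn w u') f) (i : Fin k) (a b : Fin r) :
    tipScalar f a * u i a b = u' i a b * tipScalar f b := by
  classical
  refine diagonal_intertwines (hw i) (hu i) (hu' i) (dimVec_leg_zero (r := r) μ i)
    (label hn w (leg i 0)) (fun p => by simp [label, cut_zero])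
    (fun p q => f (leg i 0) (Pi.single q 1) p) (tipScalar f) ?_ ?_ a b
  · intro p q j hj hp hq
    have hmem : (Pi.single q 1 : Fin (dimVec r μ (leg i 0)) → κ) ∈
        legFlag (echelonRep hn w u) i ⟨j, Nat.lt_succ_of_le hj⟩ := by
      rw [legFlag_echelonRep]
      intro c hc
      exact Pi.single_eq_of_ne (fun h => by subst h; simp only at hc; omega) _
    obtain ⟨x, hx⟩ := hmem
    have hmem' : f (leg i 0) (Pi.single q 1) ∈
        legFlag (echelonRep hn w u') i ⟨j, Nat.lt_succ_of_le hj⟩ := by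
      rw [← hx, Matrix.mulVecLin_apply, hom_legMap hf]
      exact LinearMap.mem_range_self (Matrix.mulVecLin _) _
    rw [legFlag_echelonRep] at hmem'
    exact hmem' p hp
  · intro p b
    have h := congrFun (hom_column hf i b) p
    rw [LinearMap.pi_apply_eq_sum_univ (f (leg i 0))] at h
    simp only [Finset.sum_apply, Pi.smul_apply, smul_eq_mul, tipMatrix_echelonRep_apply] at h
    rw [mul_comm (u' i _ _), ← h]
    refine Finset.sum_congr rfl fun q _ => ?_
    have hq : (Pi.single q 1 : Fin (dimVec r μ (leg i 0)) → κ) =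
        fun j => if q = j then 1 else 0 := by
      funext q'
      simp [Pi.single_apply, eq_comm]
    rw [mul_comm, hq]

/-- Representations in echelon form are isomorphic when the echelon forms differ by a diagonal
matrix. -/
theorem echelonRep_iso (t : Fin r → κˣ)
    (ht : ∀ i a b, (t a : κ) * u i a b = u' i a b * t b) :
    MatRep.Iso (echelonRep (μ := μ) hn w u) (echelonRep hn w u') := by
  -- Scale each basis vector by the scalar of its label; long arrows preserve labels, so only the
  -- short arrows impose a condition.
  refine ⟨fun a => LinearEquiv.piCongrRight fun x =>
    LinearEquiv.smulOfUnit (t (label hn w a x)), ?_⟩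
  intro a b γ x
  funext p
  have hγ : ∀ l m, (t l : κ) * arrowCoeff u γ l m = arrowCoeff u' γ l m * t m := by
    intro l m
    change Arrow r k s a b at γ
    cases γ with
    | short l' i => exact ht i l m
    | long i j =>
      simp only [arrowCoeff, Matrix.one_apply]
      split_ifs with h <;> simp [h]
  change (t (label hn w b p) : κ) * ((echelonRep hn w u γ).mulVec x p) =
    (echelonRep hn w u' γ).mulVec (fun y => (t (label hn w a y) : κ) * x y) p
  simp only [Matrix.mulVec, dotProduct, Finset.mul_sum, echelonRep, Matrix.of_apply]
  refine Finset.sum_congr rfl fun y _ => ?_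
  rw [← mul_assoc, hγ, mul_assoc]

theorem exists_units_of_iso (hw : ∀ i, w i ∈ blockPerms r (μ i))
    (hu : ∀ i, u i ∈ unip κ (w i)) (hu' : ∀ i, u' i ∈ unip κ (w i))
    (h : MatRep.Iso (echelonRep (μ := μ) hn w u) (echelonRep hn w u')) :
    ∃ t : Fin r → κˣ, ∀ i a b, (t a : κ) * u i a b = u' i a b * t b := by
  obtain ⟨g, hg⟩ := h
  have hg' : MatRep.IsHom (echelonRep (μ := μ) hn w u) (echelonRep hn w u')
    fun a => (g a).toLinearMap := hg
  have hne : ∀ l, tipScalar (fun a => (g a).toLinearMap) l ≠ 0 := by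
    intro l h0
    have h1 := map_tip (f := fun a => (g a).toLinearMap) (l := l) fun _ => (1 : κ)
    rw [h0, zero_smul] at h1
    have h2 := congrFun ((g (tip l)).injective (h1.trans (map_zero (g (tip l))).symm)) (0 : Fin 1)
    exact one_ne_zero h2
  exact ⟨fun l => Units.mk0 _ (hne l), fun i a b => tipScalar_intertwines hw hu hu' hg' i a b⟩

/-- Used to lift `g` from `V_{(i;0)}` to the spaces `V_{(i;j)}` embedded in it. -/
theorem exists_equiv_of_map_range {V V' W W' : Type*} [AddCommGroup V] [Module κ V]
    [AddCommGroup V'] [Module κ V'] [AddCommGroup W] [Module κ W] [AddCommGroup W'] [Module κ W']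
    {A : V →ₗ[κ] W} {B : V' →ₗ[κ] W'} (hA : Function.Injective A) (hB : Function.Injective B)
    (g : W ≃ₗ[κ] W') (h : A.range.map g.toLinearMap = B.range) :
    ∃ e : V ≃ₗ[κ] V', ∀ x, B (e x) = g (A x) := by
  let e := (LinearEquiv.ofInjective A hA).trans
    ((g.submoduleMap A.range).trans ((LinearEquiv.ofEq _ _ h).trans
      (LinearEquiv.ofInjective B hB).symm))
  refine ⟨e, fun x => ?_⟩
  have : LinearEquiv.ofInjective B hB (e x) =
      LinearEquiv.ofEq _ _ h (g.submoduleMap A.range (LinearEquiv.ofInjective A hA x)) := by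
    simp [e]
  simpa using congrArg Subtype.val this

/-- Every representation in the stratum is isomorphic to one in echelon form. -/
theorem exists_iso_echelonRep {h : ∀ i, dimVec r μ (leg i 0) ≤ r} (hφ : φ ∈ stratum κ μ h w) :
    ∃ u : Fin k → Matrix (Fin r) (Fin r) κ, (∀ i, u i ∈ unip κ (w i)) ∧
      MatRep.Iso φ (echelonRep hn w u) := by
  obtain ⟨hgood, u, hu, hg⟩ := hφ
  choose g hflag htip using hg
  refine ⟨u, hu, ?_⟩
  let G : ∀ i, (Fin (dimVec r μ (leg i 0)) → κ) ≃ₗ[κ] (Fin (dimVec r μ (leg i 0)) → κ) :=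
    fun i => Matrix.toLinearEquiv' (g i).1 ((g i).invertible)
  have hG : ∀ i x, G i x = (g i).1.mulVec x := fun i x => rfl
  have hex : ∀ i j, ∃ e : (Fin (dimVec r μ (leg i j)) → κ) ≃ₗ[κ] (Fin (dimVec r μ (leg i j)) → κ),
      ∀ x, (legMap (echelonRep hn w u) i j).mulVec (e x) = G i ((legMap φ i j).mulVec x) := by
    intro i j
    refine exists_equiv_of_map_range (A := (legMap φ i j).mulVecLin)
      (B := (legMap (echelonRep hn w u) i j).mulVecLin) (legMap_injective hgood.1 i j)
      (legMap_echelonRep_injective i j) (G i) ?_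
    have := hflag i j
    rw [← legFlag_echelonRep (hn := hn) (w := w) (u := u)] at this
    exact this
  choose e he using hex
  refine ⟨fun a => match a with
    | tip l => LinearEquiv.refl κ _
    | leg i j => e i j, ?_⟩
  intro a b γ x
  change Arrow r k s a b at γ
  cases γ with
  | short l i =>
    change e i 0 ((φ (short l i)).mulVec x) = (echelonRep hn w u (short l i)).mulVec x
    have h0 := he i 0 ((φ (short l i)).mulVec x)
    rw [legMap_zero, legMap_zero, Matrix.one_mulVec, Matrix.one_mulVec, hG] at h0
    rw [h0, short_mulVec, short_mulVec, Matrix.mulVec_smul]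
    congr 1
    funext p
    have := congrFun (congrFun (htip i) p) l
    rw [← tipMatrix_echelonRep (hn := hn) h] at this
    exact this
  | long i j =>
    change e i j.castSucc ((φ (long i j)).mulVec x) =
      (echelonRep hn w u (long i j)).mulVec (e i j.succ x)
    apply legMap_echelonRep_injective (hn := hn) (w := w) (u := u) i j.castSucc
    simp only [he]
    rw [Matrix.mulVec_mulVec, Matrix.mulVec_mulVec, ← legMap_succ, ← legMap_succ, he]

end Hom
/-! ### Indecomposability -/

section Indecomposable

variable {κ : Type*} [Field κ] {r k : ℕ} {s : Fin k → ℕ} {μ : ∀ i : Fin k, Fin (s i + 1) → ℕ}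
  {hn : ∀ i, ∑ f, μ i f ≤ r} {w : Fin k → Equiv.Perm (Fin r)}
  {u : Fin k → Matrix (Fin r) (Fin r) κ}

/-- The graph on the tips with an edge for every non-zero off-diagonal entry. -/
def supportGraph (u : Fin k → Matrix (Fin r) (Fin r) κ) : SimpleGraph (Fin r) :=
  SimpleGraph.fromRel fun a b => ∃ i, u i a b ≠ 0

theorem eq_of_reachable {t : Fin r → κ} (ht : ∀ i a b, t a * u i a b = u i a b * t b)
    {a b : Fin r} (hab : (supportGraph u).Reachable a b) : t a = t b := by
  obtain ⟨p⟩ := hab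
  induction p with
  | nil => rfl
  | cons h _ ih =>
    refine Eq.trans ?_ ih
    obtain ⟨i, hi⟩ | ⟨i, hi⟩ := ((SimpleGraph.fromRel_adj _ _ _).1 h).2
    · exact mul_right_cancel₀ hi ((ht i _ _).trans (mul_comm _ _))
    · exact (mul_right_cancel₀ hi ((ht i _ _).trans (mul_comm _ _))).symm

/-- The projection `f` onto the first summand is an idempotent endomorphism. Connectedness makes all
its tip scalars equal to one `c` with `c² = c`, so `hom_eq_zero` applies to `f` or to `1 - f`, and
one summand is zero. -/
theorem indecomposable_echelonRep (hw : ∀ i, w i ∈ blockPerms r (μ i))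
    (hu : ∀ i, u i ∈ unip κ (w i)) (hconn : (supportGraph u).Connected) :
    QRep.Indecomposable (echelonRep (μ := μ) hn w u) := by
  obtain ⟨l₀⟩ := hconn.nonempty
  refine ⟨fun h => one_ne_zero (congrFun h (tip l₀)), ?_⟩
  rintro v₁ v₂ φ₁ φ₂ ⟨g, hg⟩
  let p₁ : ∀ a : Supernova r k s,
      (Fin (v₁ a) ⊕ Fin (v₂ a) → κ) →ₗ[κ] (Fin (v₁ a) ⊕ Fin (v₂ a) → κ) :=
    fun a => LinearMap.pi (Sum.elim (fun x => LinearMap.proj (Sum.inl x)) fun _ => 0)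
  let f : ∀ a : Supernova r k s, (Fin (dimVec r μ a) → κ) →ₗ[κ] (Fin (dimVec r μ a) → κ) :=
    fun a => (g a).symm.toLinearMap ∘ₗ p₁ a ∘ₗ (g a).toLinearMap
  have hp₁ : ∀ a x, p₁ a x = Sum.elim (fun y => x (Sum.inl y)) 0 := by
    intro a x
    ext (y | y) <;> rfl
  have hpp : ∀ a x, p₁ a (p₁ a x) = p₁ a x := by
    intro a x
    ext (y | y) <;> rfl
  have hf : MatRep.IsHom (echelonRep (μ := μ) hn w u) (echelonRep hn w u) f := by
    intro a b γ x
    apply (g b).injective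
    simp only [f, LinearMap.comp_apply, LinearEquiv.coe_coe, LinearEquiv.apply_symm_apply, hg]
    simp only [MatRep.directSum, hp₁, Matrix.fromBlocks_mulVec]
    ext (y | y)
    · simp [Function.comp_def]
    · simp [Function.comp_def, Pi.zero_def, Matrix.mulVec, dotProduct]
  have hgood := echelonRep_mem_goodReps (hn := hn) hu
  obtain ⟨c, hc⟩ : ∃ c, ∀ l, tipScalar f l = c :=
    ⟨tipScalar f l₀, fun l => eq_of_reachable
      (fun i a b => tipScalar_intertwines hw hu hu hf i a b) (hconn.preconnected l l₀)⟩
  have hidem : c * c = c := by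
    have h1 := map_tip (f := f) (l := l₀) (f (tip l₀) fun _ => 1)
    have h2 : f (tip l₀) (f (tip l₀) fun _ => 1) = f (tip l₀) fun _ => 1 := by
      simp only [f, LinearMap.comp_apply, LinearEquiv.coe_coe, LinearEquiv.apply_symm_apply, hpp]
    have h3 := congrFun (h1.symm.trans h2) (0 : Fin 1)
    rw [hc] at h3
    change c * tipScalar f l₀ = tipScalar f l₀ at h3
    rwa [hc] at h3
  have hcases : c = 0 ∨ c = 1 := by
    rcases eq_or_ne c 0 with h | h
    · exact Or.inl h
    · exact Or.inr (mul_left_cancel₀ h (hidem.trans (mul_one c).symm))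
  rcases hcases with rfl | rfl
  · left
    funext a
    have hfa := hom_eq_zero hgood hgood hf (funext hc) a
    by_contra hne
    let y : Fin (v₁ a) := ⟨0, Nat.pos_of_ne_zero hne⟩
    have h1 := congrArg (g a) (LinearMap.congr_fun hfa ((g a).symm fun _ => 1))
    simp only [f, LinearMap.comp_apply, LinearEquiv.coe_coe, LinearEquiv.apply_symm_apply,
      LinearMap.zero_apply, map_zero, hp₁] at h1
    simpa using congrFun h1 (Sum.inl y)
  · right
    funext a
    have hf' : MatRep.IsHom (echelonRep (μ := μ) hn w u) (echelonRep hn w u)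
        fun a => LinearMap.id - f a := by
      intro a b γ x
      simp only [LinearMap.sub_apply, LinearMap.id_apply, hf a b γ x, Matrix.mulVec_sub]
    have h0 : tipScalar (fun a => LinearMap.id - f a) = 0 := by
      funext l
      change 1 - tipScalar f l = 0
      rw [hc, sub_self]
    have hfa := hom_eq_zero hgood hgood hf' h0 a
    by_contra hne
    let y : Fin (v₂ a) := ⟨0, Nat.pos_of_ne_zero hne⟩
    have h1 := congrArg (g a) (LinearMap.congr_fun hfa ((g a).symm fun _ => 1))
    simp only [f, LinearMap.comp_apply, LinearMap.sub_apply, LinearMap.id_apply, map_sub,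
      LinearEquiv.coe_coe, LinearEquiv.apply_symm_apply, LinearMap.zero_apply, map_zero, hp₁] at h1
    simpa using congrFun h1 (Sum.inr y)

theorem arrowCoeff_eq_zero {S : Fin r → Prop} (hS : ∀ i a b, u i a b ≠ 0 → (S a ↔ S b))
    {a b : Supernova r k s} (γ : a ⟶ b) {l m : Fin r} (h : ¬(S l ↔ S m)) :
    arrowCoeff u γ l m = 0 := by
  change Arrow r k s a b at γ
  cases γ with
  | short _ i => exact not_not.1 fun h' => h (hS i l m h')
  | long i j => exact Matrix.one_apply_ne fun h' => h (by rw [h'])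

/-- No arrow has a non-zero entry between a label in `S` and one outside, so sorting the basis
vectors by label splits the representation; the tips `l` and `m` make both parts non-zero. -/
theorem not_indecomposable_of_partition {S : Fin r → Prop}
    (hS : ∀ i a b, u i a b ≠ 0 → (S a ↔ S b)) {l m : Fin r} (hl : S l) (hm : ¬ S m) :
    ¬ QRep.Indecomposable (echelonRep (μ := μ) hn w u) := by
  classical
  rintro ⟨-, h⟩
  let e : ∀ a : Supernova r k s,
      Fin (Fintype.card {x // S (label (μ := μ) hn w a x)}) ⊕
        Fin (Fintype.card {x // ¬ S (label (μ := μ) hn w a x)}) ≃ Fin (dimVec r μ a) :=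
    fun a => (Equiv.sumCongr (Fintype.equivFin _).symm (Fintype.equivFin _).symm).trans
      (Equiv.sumCompl fun x => S (label hn w a x))
  have he₁ : ∀ a x, S (label hn w a (e a (Sum.inl x))) :=
    fun a x => ((Fintype.equivFin {x // S (label (μ := μ) hn w a x)}).symm x).2
  have he₂ : ∀ a x, ¬ S (label hn w a (e a (Sum.inr x))) :=
    fun a x => ((Fintype.equivFin {x // ¬ S (label (μ := μ) hn w a x)}).symm x).2
  have hcases := h _ _
    (fun a b γ => (echelonRep (μ := μ) hn w u γ).submatrix (e b ∘ Sum.inl) (e a ∘ Sum.inl))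
    (fun a b γ => (echelonRep (μ := μ) hn w u γ).submatrix (e b ∘ Sum.inr) (e a ∘ Sum.inr))
    ⟨fun a => LinearEquiv.funCongrLeft κ κ (e a), ?_⟩
  · rcases hcases with h0 | h0
    · exact (Fintype.card_eq_zero_iff.1 (congrFun h0 (tip l))).false ⟨(0 : Fin 1), hl⟩
    · exact (Fintype.card_eq_zero_iff.1 (congrFun h0 (tip m))).false ⟨(0 : Fin 1), hm⟩
  · intro a b γ x
    have hblocks : MatRep.directSum
        (fun a b γ => (echelonRep (μ := μ) hn w u γ).submatrix (e b ∘ Sum.inl) (e a ∘ Sum.inl))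
        (fun a b γ => (echelonRep (μ := μ) hn w u γ).submatrix (e b ∘ Sum.inr) (e a ∘ Sum.inr)) γ =
        (echelonRep (μ := μ) hn w u γ).submatrix (e b) (e a) := by
      ext (y | y) (z | z)
      · rfl
      · refine (arrowCoeff_eq_zero hS γ ?_).symm
        simp only [he₁, he₂, iff_false, not_true, not_false_eq_true]
      · refine (arrowCoeff_eq_zero hS γ ?_).symm
        simp only [he₁, he₂, iff_true, not_false_eq_true]
      · rfl
    rw [hblocks]
    change _ = ((echelonRep (μ := μ) hn w u γ).submatrix (e b) (e a)).mulVec (x ∘ e a)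
    rw [Matrix.submatrix_mulVec_equiv]
    simp [Function.comp_assoc]
    rfl

theorem connected_of_indecomposable
    (h : QRep.Indecomposable (echelonRep (μ := μ) hn w u)) : (supportGraph u).Connected := by
  -- For `r = 0` the dimension vector is zero, which is excluded by indecomposability.
  have hne : Nonempty (Fin r) := by
    by_contra hr
    rw [← Fin.pos_iff_nonempty] at hr
    refine h.1 (funext fun a => ?_)
    cases a with
    | tip l => exact absurd (Fin.pos l) hr
    | leg i j =>
      have := hn i
      simp only [dimVec, Pi.zero_apply]
      omega
  refine ⟨fun l m => ?_⟩
  by_contra hlm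
  refine not_indecomposable_of_partition (S := (supportGraph u).Reachable l) (fun i a b hab => ?_)
    (SimpleGraph.Reachable.refl l) hlm h
  rcases eq_or_ne a b with rfl | hne'
  · rfl
  · have hadj : (supportGraph u).Adj a b :=
      (SimpleGraph.fromRel_adj _ _ _).2 ⟨hne', Or.inl ⟨i, hab⟩⟩
    exact ⟨fun h => h.trans hadj.reachable, fun h => h.trans hadj.symm.reachable⟩

theorem baseChange_echelonRep (L : Type*) [Field L] [Algebra κ L] :
    MatRep.baseChange L (echelonRep (μ := μ) hn w u) =
      echelonRep hn w fun i => (u i).map (algebraMap κ L) := by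
  funext a b γ
  ext x y
  change algebraMap κ L (arrowCoeff u γ _ _) = arrowCoeff _ γ _ _
  change Arrow r k s a b at γ
  cases γ with
  | short _ i => rfl
  | long i j => simp [arrowCoeff, Matrix.one_apply]

theorem map_mem_unip (L : Type*) [Field L] [Algebra κ L] {w : Equiv.Perm (Fin r)}
    {u : Matrix (Fin r) (Fin r) κ} (hu : u ∈ unip κ w) : u.map (algebraMap κ L) ∈ unip L w :=
  ⟨fun a => by simp [hu.1], fun a b hab h => by simp [hu.2 a b hab h]⟩

theorem absolutelyIndecomposable_echelonRep {κ : Type u} [Field κ]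
    {u : Fin k → Matrix (Fin r) (Fin r) κ} (hw : ∀ i, w i ∈ blockPerms r (μ i))
    (hu : ∀ i, u i ∈ unip κ (w i)) (hconn : (supportGraph u).Connected) :
    QRep.AbsolutelyIndecomposable (echelonRep (μ := μ) hn w u) := by
  refine ⟨indecomposable_echelonRep hw hu hconn, fun L _ _ _ => ?_⟩
  rw [baseChange_echelonRep]
  refine indecomposable_echelonRep hw (fun i => map_mem_unip L (hu i)) ?_
  -- The embedding `κ → L` is injective, so the support graph is unchanged.
  convert hconn using 1
  simp [supportGraph]

end Indecomposable

/-! ### Counting -/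

section Count

theorem card_le_of_edgesConnected {r k : ℕ} {A : Finset (Fin k × Fin r × Fin r)}
    (h : EdgesConnected A) : r ≤ A.card + 1 := by
  classical
  have h1 := SimpleGraph.Connected.card_vert_le_card_edgeSet_add_one h
  rw [Nat.card_eq_fintype_card, Fintype.card_fin] at h1
  refine h1.trans (Nat.add_le_add_right ?_ 1)
  have hsub : (SimpleGraph.fromRel fun a b : Fin r => ∃ t, (t, a, b) ∈ A).edgeSet ⊆
      (A.image fun e => s(e.2.1, e.2.2) : Finset (Sym2 (Fin r))) := by
    intro e
    induction e with
    | _ a b =>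
      rw [SimpleGraph.mem_edgeSet, SimpleGraph.fromRel_adj]
      rintro ⟨-, ⟨t, ht⟩ | ⟨t, ht⟩⟩
      · exact Finset.mem_coe.2 (Finset.mem_image.2 ⟨_, ht, rfl⟩)
      · exact Finset.mem_coe.2 (Finset.mem_image.2 ⟨_, ht, Sym2.eq_swap⟩)
  calc Nat.card _ = Set.ncard _ := Nat.card_coe_set_eq _
    _ ≤ Set.ncard (↑(A.image fun e => s(e.2.1, e.2.2)) : Set (Sym2 (Fin r))) :=
        Set.ncard_le_ncard hsub (Finset.finite_toSet _)
    _ ≤ A.card := by rw [Set.ncard_coe_finset]; exact Finset.card_image_le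

variable {F : Type*} [Field F] [Fintype F]

/-- The number of functions with prescribed support. -/
theorem card_filter_support_eq {E : Type*} [Fintype E] [DecidableEq E] [DecidableEq F]
    (A : Finset E) :
    (Finset.univ.filter fun x : E → F => (Finset.univ.filter fun e => x e ≠ 0) = A).card =
      (Fintype.card F - 1) ^ A.card := by
  have : (Finset.univ.filter fun x : E → F => (Finset.univ.filter fun e => x e ≠ 0) = A) =
      Fintype.piFinset fun e => if e ∈ A then Finset.univ.erase (0 : F) else {0} := by
    ext x
    simp only [Finset.mem_filter, Finset.mem_univ, true_and, Finset.ext_iff, Fintype.mem_piFinset]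
    refine forall_congr' fun e => ?_
    by_cases he : e ∈ A <;> simp [he]
  rw [this, Fintype.card_piFinset]
  simp only [apply_ite Finset.card, Finset.card_erase_of_mem (Finset.mem_univ _),
    Finset.card_univ, Finset.card_singleton]
  rw [Finset.prod_ite_mem, Finset.univ_inter, Finset.prod_const]

/-- The normalization `t l₀ = 1` picks one representative of each class of the torus modulo scalars.
-/
theorem card_filter_units_eq_one {r : ℕ} (l₀ : Fin r) [DecidableEq F] :
    (Finset.univ.filter fun t : Fin r → Fˣ => t l₀ = 1).card = (Fintype.card F - 1) ^ (r - 1) := by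
  have : (Finset.univ.filter fun t : Fin r → Fˣ => t l₀ = 1) =
      Fintype.piFinset fun l => if l ∈ Finset.univ.erase l₀ then Finset.univ else {1} := by
    ext t
    simp only [Finset.mem_filter, Finset.mem_univ, true_and, Fintype.mem_piFinset,
      Finset.mem_erase, and_true]
    constructor
    · intro h l
      by_cases hl : l = l₀
      · subst hl; simp [h]
      · simp [hl]
    · intro h
      simpa using h l₀
  rw [this, Fintype.card_piFinset]
  simp only [apply_ite Finset.card, Finset.card_univ, Finset.card_singleton]
  rw [Finset.prod_ite_mem, Finset.univ_inter, Finset.prod_const,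
    Finset.card_erase_of_mem (Finset.mem_univ _), Finset.card_univ, Fintype.card_fin,
    Fintype.card_units]

end Count
-- Isomorphism classes as torus orbits
section Orbits

variable {κ : Type*} [Field κ] {r k : ℕ} {s : Fin k → ℕ} {μ : ∀ i : Fin k, Fin (s i + 1) → ℕ}
  {hn : ∀ i, ∑ f, μ i f ≤ r} {w : Fin k → Equiv.Perm (Fin r)}

/-- The matrices with diagonal entries `1` and off-diagonal entries given by `x`. -/
def unipOf (x : Fin k × Fin r × Fin r → κ) (i : Fin k) : Matrix (Fin r) (Fin r) κ :=
  Matrix.of fun a b => if a = b then 1 else x (i, a, b)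

open Classical in
/-- The support of a function as a finite set. -/
noncomputable def supp (x : Fin k × Fin r × Fin r → κ) : Finset (Fin k × Fin r × Fin r) :=
  Finset.univ.filter fun e => x e ≠ 0

theorem mem_supp {x : Fin k × Fin r × Fin r → κ} {e} : e ∈ supp x ↔ x e ≠ 0 := by simp [supp]

theorem mem_invEdges {i : Fin k} {a b : Fin r} :
    (i, a, b) ∈ invEdges w ↔ b < a ∧ w i a < w i b := by simp [invEdges]

theorem unipOf_apply_ne (x : Fin k × Fin r × Fin r → κ) (i : Fin k) {a b : Fin r} (h : a ≠ b) :
    unipOf x i a b = x (i, a, b) := by simp [unipOf, h]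

theorem unipOf_mem_unip {x : Fin k × Fin r × Fin r → κ} (hx : supp x ⊆ invEdges w) (i : Fin k) :
    unipOf x i ∈ unip κ (w i) := by
  refine ⟨fun a => by simp [unipOf], fun a b hab h => ?_⟩
  rw [unipOf_apply_ne _ _ hab]
  by_contra hne
  exact h (mem_invEdges.1 (hx (mem_supp.2 hne)))

theorem apply_diag {x : Fin k × Fin r × Fin r → κ} (hx : supp x ⊆ invEdges w) (i : Fin k)
    (a : Fin r) : x (i, a, a) = 0 := by
  by_contra hne
  exact (mem_invEdges.1 (hx (mem_supp.2 hne))).1.false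

theorem exists_eq_unipOf {u : Fin k → Matrix (Fin r) (Fin r) κ} (hu : ∀ i, u i ∈ unip κ (w i)) :
    ∃ x : Fin k × Fin r × Fin r → κ, supp x ⊆ invEdges w ∧ unipOf x = u := by
  refine ⟨fun e => if e.2.1 = e.2.2 then 0 else u e.1 e.2.1 e.2.2, ?_, ?_⟩
  · rintro ⟨i, a, b⟩ h
    rw [mem_supp] at h
    simp only [ne_eq, ite_eq_left_iff, not_forall] at h
    rw [mem_invEdges]
    by_contra hcon
    exact h.2 ((hu i).2 a b h.1 hcon)
  · funext i
    ext a b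
    by_cases hab : a = b
    · subst hab
      simp [unipOf, (hu i).1]
    · simp [unipOf, hab]

theorem supportGraph_unipOf_connected_iff {x : Fin k × Fin r × Fin r → κ} :
    (supportGraph (unipOf x)).Connected ↔ EdgesConnected (supp x) := by
  have : supportGraph (unipOf x) =
      SimpleGraph.fromRel fun a b : Fin r => ∃ t, (t, a, b) ∈ supp x := by
    ext a b
    rw [supportGraph, SimpleGraph.fromRel_adj, SimpleGraph.fromRel_adj]
    refine and_congr_right fun hab => ?_
    simp only [unipOf_apply_ne _ _ hab, unipOf_apply_ne _ _ hab.symm, mem_supp]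
  rw [this, EdgesConnected]

/-- The action of the diagonal torus. -/
def torusAct (t : Fin r → κˣ) (x : Fin k × Fin r × Fin r → κ) : Fin k × Fin r × Fin r → κ :=
  fun e => t e.2.1 * x e * ↑(t e.2.2)⁻¹

theorem supp_torusAct (t : Fin r → κˣ) (x : Fin k × Fin r × Fin r → κ) :
    supp (torusAct t x) = supp x := by
  ext e
  simp [mem_supp, torusAct]

theorem iso_unipOf_iff (hw : ∀ i, w i ∈ blockPerms r (μ i)) {x y : Fin k × Fin r × Fin r → κ}
    (hx : supp x ⊆ invEdges w) (hy : supp y ⊆ invEdges w) (l₀ : Fin r) :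
    MatRep.Iso (echelonRep (μ := μ) hn w (unipOf x)) (echelonRep hn w (unipOf y)) ↔
      ∃ t : Fin r → κˣ, t l₀ = 1 ∧ torusAct t x = y := by
  constructor
  · intro h
    obtain ⟨t, ht⟩ := exists_units_of_iso hw (unipOf_mem_unip hx) (unipOf_mem_unip hy) h
    -- Scalars act trivially by conjugation, so `t` may be divided by `t l₀`.
    refine ⟨fun l => t l * (t l₀)⁻¹, mul_inv_cancel _, ?_⟩
    funext ⟨i, a, b⟩
    by_cases hab : a = b
    · subst hab
      simp [torusAct, apply_diag hx, apply_diag hy]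
    · have := ht i a b
      rw [unipOf_apply_ne _ _ hab, unipOf_apply_ne _ _ hab] at this
      simp only [torusAct, Units.val_mul, mul_inv_rev, inv_inv]
      calc (t a : κ) * ↑(t l₀)⁻¹ * x (i, a, b) * (↑(t l₀) * ↑(t b)⁻¹)
          = (t a * x (i, a, b)) * ↑(t b)⁻¹ * (↑(t l₀)⁻¹ * t l₀) := by ring
        _ = y (i, a, b) := by rw [this, Units.inv_mul, mul_one, mul_assoc, Units.mul_inv, mul_one]
  · rintro ⟨t, -, rfl⟩
    refine echelonRep_iso t fun i a b => ?_
    by_cases hab : a = b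
    · subst hab
      simp [unipOf]
    · rw [unipOf_apply_ne _ _ hab, unipOf_apply_ne _ _ hab]
      simp only [torusAct]
      rw [mul_assoc, Units.inv_mul, mul_one]

/-- The quotient `t / t'` fixes `x`, so it is constant along the edges of the support; by
connectedness it equals its value `1` at `l₀`. -/
theorem torusAct_injOn {x : Fin k × Fin r × Fin r → κ}
    (hconn : EdgesConnected (supp x)) (l₀ : Fin r) {t t' : Fin r → κˣ} (ht : t l₀ = 1)
    (ht' : t' l₀ = 1) (h : torusAct t x = torusAct t' x) : t = t' := by
  have hc := supportGraph_unipOf_connected_iff.2 hconn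
  have key : ∀ l, ((t l * (t' l)⁻¹ : κˣ) : κ) = ((t l₀ * (t' l₀)⁻¹ : κˣ) : κ) := fun l =>
    eq_of_reachable (t := fun l => ((t l * (t' l)⁻¹ : κˣ) : κ)) (u := unipOf x) (fun i a b => by
      by_cases hab : a = b
      · subst hab
        simp [unipOf]
      · rw [unipOf_apply_ne _ _ hab]
        have h1 : (t a : κ) * x (i, a, b) * ↑(t b)⁻¹ = t' a * x (i, a, b) * ↑(t' b)⁻¹ :=
          congrFun h (i, a, b)
        have h2 : (t a : κ) * x (i, a, b) = t' a * x (i, a, b) * ↑(t' b)⁻¹ * t b := by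
          rw [← h1, mul_assoc, Units.inv_mul, mul_one]
        simp only [Units.val_mul]
        calc (t a : κ) * ↑(t' a)⁻¹ * x (i, a, b) = t a * x (i, a, b) * ↑(t' a)⁻¹ := by ring
          _ = x (i, a, b) * (↑(t b) * ↑(t' b)⁻¹) * (t' a * ↑(t' a)⁻¹) := by rw [h2]; ring
          _ = x (i, a, b) * (↑(t b) * ↑(t' b)⁻¹) := by rw [Units.mul_inv, mul_one])
      (hc.preconnected l l₀)
  funext l
  have := Units.ext (key l)
  rwa [ht, ht', inv_one, mul_one, mul_inv_eq_one] at this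

end Orbits

/-! ### Counting orbits with connected support -/

section Count

variable {F : Type*} [Field F] [Fintype F] {r k : ℕ} {s : Fin k → ℕ}
  {μ : ∀ i : Fin k, Fin (s i + 1) → ℕ}

open Classical in
/-- The parameters of the absolutely indecomposable representations in echelon form. -/
noncomputable def connectedParams (F : Type*) [Field F] [Fintype F]
    (w : Fin k → Equiv.Perm (Fin r)) : Finset (Fin k × Fin r × Fin r → F) :=
  Finset.univ.filter fun x => supp x ⊆ invEdges w ∧ EdgesConnected (supp x)

theorem mem_connectedParams {w : Fin k → Equiv.Perm (Fin r)} {x : Fin k × Fin r × Fin r → F} :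
    x ∈ connectedParams F w ↔ supp x ⊆ invEdges w ∧ EdgesConnected (supp x) := by
  simp [connectedParams]

open Classical in
theorem card_connectedParams (w : Fin k → Equiv.Perm (Fin r)) :
    (connectedParams F w).card =
      ∑ A ∈ (invEdges w).powerset with EdgesConnected A, (Fintype.card F - 1) ^ A.card := by
  rw [Finset.card_eq_sum_card_fiberwise (f := supp)
    (t := (invEdges w).powerset.filter EdgesConnected)]
  · refine Finset.sum_congr rfl fun A hA => ?_
    rw [Finset.mem_filter, Finset.mem_powerset] at hA
    rw [← card_filter_support_eq (F := F) A]
    congr 1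
    ext x
    simp only [Finset.mem_filter, mem_connectedParams, Finset.mem_univ, true_and]
    constructor
    · rintro ⟨-, rfl⟩
      rw [supp]
    · intro h
      have h' : supp x = A := by rw [← h, supp]
      exact ⟨by rwa [h'], h'⟩
  · intro x hx
    simpa [mem_connectedParams] using hx

open Classical in
-- Each fibre of the map to isomorphism classes is one orbit, on which the `(q-1)^(r-1)` normalized
-- torus elements act simply transitively.
theorem card_image_isoClass_mul (hn : ∀ i, ∑ f, μ i f ≤ r) {w : Fin k → Equiv.Perm (Fin r)}
    (hw : ∀ i, w i ∈ blockPerms r (μ i)) :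
    ((connectedParams F w).image fun x =>
      QRep.isoClass (echelonRep (μ := μ) hn w (unipOf x))).card * (Fintype.card F - 1) ^ (r - 1) =
      (connectedParams F w).card := by
  rw [Finset.card_eq_sum_card_image
    (fun x => QRep.isoClass (echelonRep (μ := μ) hn w (unipOf x))) (connectedParams F w),
    Finset.sum_const_nat]
  intro c hc
  obtain ⟨x, hx, rfl⟩ := Finset.mem_image.1 hc
  have hx' := mem_connectedParams.1 hx
  obtain ⟨l₀⟩ : Nonempty (Fin r) := hx'.2.nonempty
  rw [← card_filter_units_eq_one (F := F) l₀,
    ← Finset.card_image_of_injOn (s := Finset.univ.filter fun t : Fin r → Fˣ => t l₀ = 1)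
      (f := fun t => torusAct t x)]
  · congr 1
    ext y
    simp only [Finset.mem_filter, Finset.mem_image, Finset.mem_univ, true_and]
    constructor
    · rintro ⟨hy, h⟩
      have hiso := (QRep.isoSetoid F (dimVec r μ)).symm (Quotient.exact h)
      exact (iso_unipOf_iff hw hx'.1 (mem_connectedParams.1 hy).1 l₀).1 hiso
    · rintro ⟨t, ht, rfl⟩
      have hy : torusAct t x ∈ connectedParams F w := by
        rw [mem_connectedParams, supp_torusAct]
        exact hx'
      refine ⟨hy, Quotient.sound ((QRep.isoSetoid F (dimVec r μ)).symm ?_)⟩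
      exact (iso_unipOf_iff hw hx'.1 (mem_connectedParams.1 hy).1 l₀).2 ⟨t, ht, rfl⟩
  · intro t ht t' ht' h
    exact torusAct_injOn hx'.2 l₀ (by simpa using ht) (by simpa using ht') h

theorem indecomposable_of_iso {κ : Type*} [Field κ] {I : Type*} [Quiver I] {v : I → ℕ}
    {φ ψ : QRep κ v} (h : MatRep.Iso φ ψ) (hφ : QRep.Indecomposable φ) :
    QRep.Indecomposable ψ := by
  refine ⟨hφ.1, fun v₁ v₂ φ₁ φ₂ h' => hφ.2 v₁ v₂ φ₁ φ₂ ?_⟩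
  obtain ⟨g, hg⟩ := h
  obtain ⟨g', hg'⟩ := h'
  exact ⟨fun a => (g a).trans (g' a), fun a b γ x => by
    simp only [LinearEquiv.trans_apply, hg, hg']⟩

open Classical in
theorem setOf_isoClass_eq_image (hn : ∀ i, ∑ f, μ i f ≤ r) (h : ∀ i, dimVec r μ (leg i 0) ≤ r)
    {w : Fin k → Equiv.Perm (Fin r)} (hw : ∀ i, w i ∈ blockPerms r (μ i)) :
    {c : QRep.IsoClass F (dimVec r μ) | ∃ φ ∈ stratum F μ h w,
      QRep.AbsolutelyIndecomposable φ ∧ QRep.isoClass φ = c} =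
    ((connectedParams F w).image fun x =>
      QRep.isoClass (echelonRep (μ := μ) hn w (unipOf x)) :) := by
  ext c
  simp only [Set.mem_ofPred_eq, Finset.coe_image, Set.mem_image, Finset.mem_coe,
    mem_connectedParams]
  constructor
  · rintro ⟨φ, hφ, hind, rfl⟩
    obtain ⟨u, hu, hiso⟩ := exists_iso_echelonRep (hn := hn) hφ
    obtain ⟨x, hx, rfl⟩ := exists_eq_unipOf hu
    have hconn := connected_of_indecomposable (indecomposable_of_iso hiso hind.1)
    exact ⟨x, ⟨hx, supportGraph_unipOf_connected_iff.1 hconn⟩,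
      Quotient.sound ((QRep.isoSetoid F (dimVec r μ)).symm hiso)⟩
  · rintro ⟨x, ⟨hx, hconn⟩, rfl⟩
    exact ⟨_, echelonRep_mem_stratum h (unipOf_mem_unip hx),
      absolutelyIndecomposable_echelonRep hw (unipOf_mem_unip hx)
        (supportGraph_unipOf_connected_iff.2 hconn), rfl⟩

end Count
end Supernova

/-- `R_w(q)` is the number of isomorphism classes of absolutely indecomposable representations
over the field with `q` elements that lie in the stratum of `w`. -/
theorem theorem3p9 (r k : ℕ) (s : Fin k → ℕ) (μ : ∀ i : Fin k, Fin (s i + 1) → ℕ)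
    (hμ : ∀ i, Antitone (μ i)) (hμ0 : ∀ i, μ i ≠ 0)
    (hr : ∀ i, (∑ f, μ i f) + μ i 0 ≤ r)
    (w : Fin k → Equiv.Perm (Fin r)) (hw : ∀ i, w i ∈ Supernova.blockPerms r (μ i))
    (F : Type*) [Field F] [Fintype F] :
    (({c : QRep.IsoClass F (Supernova.dimVec r μ) |
        ∃ φ ∈ Supernova.stratum F μ
            (fun i => (Supernova.dimVec_leg_zero (r := r) μ i).trans_le (le_of_add_le_left (hr i))) w,
          QRep.AbsolutelyIndecomposable φ ∧ QRep.isoClass φ = c}.ncard : ℕ) : ℤ) =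
      (Supernova.Rpoly w).eval (Fintype.card F : ℤ) := by

  classical
  have hn : ∀ i, ∑ f, μ i f ≤ r := fun i => le_of_add_le_left (hr i)
  rw [Supernova.setOf_isoClass_eq_image hn _ hw, Set.ncard_coe_finset]
  have hq : 1 < Fintype.card F := Fintype.one_lt_card
  have hq0 : ((Fintype.card F - 1 : ℕ) : ℤ) ^ (r - 1) ≠ 0 :=
    pow_ne_zero _ (by exact_mod_cast (Nat.sub_pos_of_lt hq).ne')
  -- Multiplying by the orbit size turns the claim into a count of parameters.
  refine mul_right_cancel₀ hq0 ?_
  rw [← Nat.cast_pow, ← Nat.cast_mul, Supernova.card_image_isoClass_mul hn hw,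
    Supernova.card_connectedParams, Supernova.Rpoly, Polynomial.eval_finsetSum, Finset.sum_mul,
    Nat.cast_sum]
  refine Finset.sum_congr (by congr) fun A hA => ?_
  have hconn := (Finset.mem_filter.1 hA).2
  have hle := Supernova.card_le_of_edgesConnected hconn
  have hpos : 0 < r := Fin.pos_iff_nonempty.2 hconn.nonempty
  rw [Polynomial.eval_pow, Polynomial.eval_sub, Polynomial.eval_X, Polynomial.eval_one,
    Nat.cast_pow, Nat.cast_pow, Nat.cast_sub hq.le, Nat.cast_one, ← pow_add]
  congr 1
  -- The exponents satisfy `(|A| + 1 - r) + (r - 1) = |A|`; the truncated subtractions are exact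
  -- because `r ≤ |A| + 1` and `0 < r`.
  omega
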